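/- Let $m,p,s,N\ge 1$ be integers with $m\le p$ and $s\le p$, and let $\sigma>0$. Let $x$ be a zero-mean random vector in $\mathbb{R}^p$ with finite second moments and known law, whose support $\operatorname{supp}(x)=\{i: x_i\neq 0\}$ is uniformly distributed over the $\binom{p}{s}$ subsets $\mathcal{S}\subseteq\{1,\dots,p\}$ of size $s$, and whose non-zero entries satisfy $\mathrm{E}\{x_{\mathcal{S}}x_{\mathcal{S}}^T \mid \operatorname{supp}(x)=\mathcal{S}\}=\sigma_a^2 I_s$ for each such $\mathcal{S}$. Let $n\sim\mathcal{N}(0,\sigma^2 I_m)$ be independent of $x$. For a matrix $D\in\mathbb{R}^{m\times p}$ let $Y=(y_1,\dots,y_N)$ consist of $N$ i.i.d. copies of $y=Dx+n$. Let $\mathcal{D}$ be the set of the matrices in $\mathbb{R}^{m\times p}$ whose columns all have unit Euclidean norm; for $D_0\in\mathcal{D}$ and $0<r\le 2\sqrt{p}$ put $\mathcal{X}(D_0,r)=\{D'\in\mathcal{D}:\|D'-D_0\|_F<r\}$ and define the minimax risk $$\varepsilon^*=\inf_{\widehat D}\ \sup_{D'\in\mathcal{X}(D_0,r)}\mathrm{E}_{Y}\{\|\widehat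 D(Y)-D'\|_F^2\},$$ where the data $Y$ in the expectation are generated with $D'$ and the infimum is over all measurable estimators $\widehat D:\mathbb{R}^{m\times N}\to\mathbb{R}^{m\times p}$. Let the true dictionary $D\in\mathcal{X}(D_0,r)$ satisfy the restricted isometry property of order $s$ with a constant $\delta_s\le 1/2$, that is, $(1-\delta_s)\|z\|^2\le\|Dz\|^2\le(1+\delta_s)\|z\|^2$ for all $z\in\mathbb{R}^p$ with at most $s$ non-zero entries, and let $\mathrm{SNR}=\mathrm{E}\{\|Dx\|_2^2\}/\mathrm{E}\{\|n\|_2^2\}$. If $p(m-1)\ge 50$, then $\mathrm{E}\{xx^T\}=(s/p)\sigma_a^2 I_p$ and $$\varepsilon^*\ \ge\ \frac{1}{320}\min\Big\{r^2,\ \frac{2p}{\mathrm{SNR}\cdot N\cdot m}\Big(\frac{p(m-1)}{10}-1\Big)\Big\}.$$ -/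

import Mathlib

open MeasureTheory ProbabilityTheory
open scoped ENNReal NNReal

noncomputable section

namespace DictLearning

open scoped Matrix.Norms.Frobenius

variable {m p : ℕ}

/-- Squared Euclidean norm `‖v‖₂²`. -/
def sqNorm {n : ℕ} (v : Fin n → ℝ) : ℝ := ∑ i, v i ^ 2

/-- The support of a vector. -/
def supp {n : ℕ} (v : Fin n → ℝ) : Finset (Fin n) := {i | v i ≠ 0}

/-- The oblique manifold: `m × p` matrices whose columns have unit Euclidean norm. -/
def dictionaries (m p : ℕ) : Set (Matrix (Fin m) (Fin p) ℝ) :=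
  {B | ∀ k, (B.transpose * B) k k = 1}

/-- `𝒳(D₀, r)`: the dictionaries at Frobenius distance less than `r` from `D₀`. -/
def neighborhood (D₀ : Matrix (Fin m) (Fin p) ℝ) (r : ℝ) : Set (Matrix (Fin m) (Fin p) ℝ) :=
  {D | D ∈ dictionaries m p ∧ ‖D - D₀‖ < r}

/-- `D` satisfies the restricted isometry property of order `s` with constant `δ`. -/
def HasRIP (D : Matrix (Fin m) (Fin p) ℝ) (s : ℕ) (δ : ℝ) : Prop :=
  ∀ z : Fin p → ℝ, (supp z).card ≤ s →
    (1 - δ) * sqNorm z ≤ sqNorm (D.mulVec z) ∧ sqNorm (D.mulVec z) ≤ (1 + δ) * sqNorm z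

/-- `μx` is the law of a zero-mean random vector with finite second moments, whose support is
uniformly distributed over the `s`-element subsets of the index set and whose non-zero entries
have, given that the support is `S`, the second moment matrix `σa² I`. -/
structure IsSparseCoeffLaw (s : ℕ) (σa : ℝ) (μx : Measure (Fin p → ℝ)) : Prop where
  memLp_two : ∀ i, MemLp (fun x : Fin p → ℝ => x i) 2 μx
  mean_zero : ∀ i, ∫ x, x i ∂μx = 0
  supp_uniform : ∀ S : Finset (Fin p), S.card = s →
    μx.real {x | supp x = S} = 1 / (p.choose s : ℝ)
  cond_cov : ∀ S : Finset (Fin p), S.card = s → ∀ i ∈ S, ∀ j ∈ S,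
    ∫ x, x i * x j ∂(μx[|{x | supp x = S}]) = if i = j then σa ^ 2 else 0

/-- The law of white Gaussian noise in `ℝᵐ` with variance `σ²` per component. -/
def noiseLaw (m : ℕ) (σ : ℝ≥0) : Measure (Fin m → ℝ) :=
  Measure.pi fun _ => gaussianReal 0 (σ ^ 2)

/-- The law of one observation `y = D x + n`, with `x ∼ μx` and `n` independent. -/
def obsLaw (μx : Measure (Fin p → ℝ)) (σ : ℝ≥0) (D : Matrix (Fin m) (Fin p) ℝ) :
    Measure (Fin m → ℝ) :=
  (μx.prod (noiseLaw m σ)).map fun xn => D.mulVec xn.1 + xn.2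

/-- The law of the data `Y = (y₁, …, y_N)`, which consists of `N` i.i.d. observations. -/
def dataLaw (μx : Measure (Fin p → ℝ)) (σ : ℝ≥0) (N : ℕ) (D : Matrix (Fin m) (Fin p) ℝ) :
    Measure (Fin N → Fin m → ℝ) :=
  Measure.pi fun _ => obsLaw μx σ D

/-- The mean squared error (in Frobenius norm) of the estimator `Dhat` when the true
dictionary is `D`. -/
def mse (μx : Measure (Fin p → ℝ)) (σ : ℝ≥0) (N : ℕ)
    (Dhat : (Fin N → Fin m → ℝ) → Matrix (Fin m) (Fin p) ℝ) (D : Matrix (Fin m) (Fin p) ℝ) :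
    ℝ≥0∞ :=
  ∫⁻ Y, ENNReal.ofReal (‖Dhat Y - D‖ ^ 2) ∂(dataLaw μx σ N D)

/-- The minimax risk: infimum over all (measurable) estimators of the worst-case mean squared
error over the neighborhood of `D₀`. -/
def minimaxRisk (μx : Measure (Fin p → ℝ)) (σ : ℝ≥0) (N : ℕ)
    (D₀ : Matrix (Fin m) (Fin p) ℝ) (r : ℝ) : ℝ≥0∞ :=
  ⨅ (Dhat : (Fin N → Fin m → ℝ) → Matrix (Fin m) (Fin p) ℝ)
    (_ : ∀ i j, Measurable fun Y => Dhat Y i j),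
    ⨆ D ∈ neighborhood D₀ r, mse μx σ N Dhat D

/-- The signal-to-noise ratio `E ‖D x‖² / E ‖n‖²`. -/
def SNR (μx : Measure (Fin p → ℝ)) (σ : ℝ≥0) (D : Matrix (Fin m) (Fin p) ℝ) : ℝ :=
  (∫ x, sqNorm (D.mulVec x) ∂μx) / ∫ n, sqNorm n ∂(noiseLaw m σ)

end DictLearning

end

/-!
Rotating each column of `D₀` onto the first basis vector and moving its remaining `m - 1`
coordinates from `0` to `±ε` produces a hypercube of `2 ^ (p (m - 1))` dictionaries near `D₀`.
Rotations preserve the Frobenius norm, so the squared error of an estimator dominates the sum over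
the coordinates of the squared errors in estimating `±ε`, and Assouad's lemma reduces the risk to
testing two adjacent vertices. There the coefficients `x` may be revealed to the estimator: given
`x`, the observations are Gaussian, with the affinity `exp (-‖(D - D') x‖² / (8 σ²))`, and by
Jensen's inequality its mean is bounded below in terms of `E ‖(D - D') x‖²`, which is `‖D - D'‖²`
times a constant proportional to the SNR. It remains to choose `ε`.
-/

noncomputable section

namespace DictLearning

open scoped Matrix.Norms.Frobenius

section Product

variable {ι : Type*} [Fintype ι] {E : ι → Type*} [∀ i, MeasurableSpace (E i)]

theorem lintegral_fin_nat_prod_eq_prod {n : ℕ} {E : Fin n → Type*} [∀ i, MeasurableSpace (E i)]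
    (μ : ∀ i, Measure (E i)) [∀ i, SigmaFinite (μ i)] {f : ∀ i, E i → ℝ≥0∞}
    (hf : ∀ i, Measurable (f i)) :
    ∫⁻ x, ∏ i, f i (x i) ∂(Measure.pi μ) = ∏ i, ∫⁻ x, f i x ∂(μ i) := by
  induction n with
  | zero => simp
  | succ n ih =>
    rw [← (measurePreserving_piFinSuccAbove μ 0).symm.lintegral_comp (by fun_prop)]
    simp_rw [MeasurableEquiv.piFinSuccAbove_symm_apply, Fin.insertNthEquiv, Fin.prod_univ_succ,
      Fin.insertNth_zero, Equiv.coe_fn_mk, Fin.cons_succ, Fin.cons_zero]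
    rw [← ih _ fun i => hf i.succ]
    have measurable_tail : Measurable fun x : ∀ i : Fin n, E i.succ => ∏ i, f i.succ (x i) := by
      fun_prop
    exact lintegral_prod_mul (μ := μ 0) (ν := Measure.pi fun i : Fin n => μ i.succ)
      (hf 0).aemeasurable measurable_tail.aemeasurable

theorem lintegral_fintype_prod_eq_prod (μ : ∀ i, Measure (E i)) [∀ i, SigmaFinite (μ i)]
    {f : ∀ i, E i → ℝ≥0∞} (hf : ∀ i, Measurable (f i)) :
    ∫⁻ x, ∏ i, f i (x i) ∂(Measure.pi μ) = ∏ i, ∫⁻ x, f i x ∂(μ i) := by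
  let e := (Fintype.equivFin ι).symm
  rw [← (measurePreserving_piCongrLeft μ e).lintegral_comp (by fun_prop)]
  simp_rw [← e.prod_comp, MeasurableEquiv.coe_piCongrLeft, Equiv.piCongrLeft_apply_apply]
  exact lintegral_fin_nat_prod_eq_prod _ fun i => hf (e i)

theorem pi_withDensity (μ : ∀ i, Measure (E i)) [∀ i, SigmaFinite (μ i)]
    {f : ∀ i, E i → ℝ≥0∞} (hf : ∀ i, Measurable (f i))
    [∀ i, SigmaFinite ((μ i).withDensity (f i))] :
    Measure.pi (fun i => (μ i).withDensity (f i)) =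
      (Measure.pi μ).withDensity fun x => ∏ i, f i (x i) := by
  classical
  refine Measure.pi_eq fun s hs => ?_
  have indicator_pi (x : ∀ i, E i) : (Set.univ.pi s).indicator (fun x => ∏ i, f i (x i)) x =
      ∏ i, (s i).indicator (f i) (x i) := by
    simp only [Set.indicator_apply, Set.mem_univ_pi, Finset.prod_ite_zero, Finset.mem_univ,
      true_imp_iff]
  rw [withDensity_apply _ (.univ_pi hs), ← lintegral_indicator (.univ_pi hs)]
  simp_rw [indicator_pi]
  rw [lintegral_fintype_prod_eq_prod μ fun i => (hf i).indicator (hs i)]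
  exact Finset.prod_congr rfl fun i _ => by
    rw [lintegral_indicator (hs i), withDensity_apply _ (hs i)]

end Product

section Affinity

variable {α β : Type*} [MeasurableSpace α] [MeasurableSpace β]

/-- The Hellinger affinity `∫ √(p q) dμ` of the measures with the densities `p` and `q` with
respect to `μ`. It measures how hard it is to tell the two measures apart, and it is multiplicative
over products. -/
def affinity (μ : Measure α) (p q : α → ℝ≥0∞) : ℝ≥0∞ :=
  ∫⁻ a, (p a * q a) ^ (1 / 2 : ℝ) ∂μ

theorem affinity_pi {ι : Type*} [Fintype ι] (μ : Measure α) [SigmaFinite μ]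
    {p q : ι → α → ℝ≥0∞} (hp : ∀ i, Measurable (p i)) (hq : ∀ i, Measurable (q i)) :
    affinity (Measure.pi fun _ => μ) (fun x => ∏ i, p i (x i)) (fun x => ∏ i, q i (x i)) =
      ∏ i, affinity μ (p i) (q i) := by
  simp only [affinity, ← Finset.prod_mul_distrib,
    ← ENNReal.prod_rpow_of_nonneg (one_half_pos (α := ℝ)).le]
  exact lintegral_fintype_prod_eq_prod (fun _ => μ) fun i => ((hp i).mul (hq i)).pow_const _

theorem lintegral_mul_sqrt_le {μ : Measure α} {p q u : α → ℝ≥0∞} (hp : Measurable p)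
    (hq : Measurable q) (hu : Measurable u) [IsProbabilityMeasure (μ.withDensity q)] :
    ∫⁻ a, u a * (p a * q a) ^ (1 / 2 : ℝ) ∂μ ≤
      (∫⁻ a, u a ^ 2 ∂(μ.withDensity p)) ^ (1 / 2 : ℝ) := by
  have hq_one : ∫⁻ a, q a ∂μ = 1 := by
    rw [← setLIntegral_univ, ← withDensity_apply _ .univ, measure_univ]
  calc ∫⁻ a, u a * (p a * q a) ^ (1 / 2 : ℝ) ∂μ
      = ∫⁻ a, (p a * u a ^ 2) ^ (1 / 2 : ℝ) * q a ^ (1 / 2 : ℝ) ∂μ := by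
        refine lintegral_congr fun a => ?_
        rw [← ENNReal.mul_rpow_of_nonneg _ _ (by norm_num), mul_right_comm,
          ENNReal.mul_rpow_of_nonneg _ (u a ^ 2) (by norm_num), ← ENNReal.rpow_natCast_mul]
        norm_num [mul_comm]
    _ ≤ (∫⁻ a, p a * u a ^ 2 ∂μ) ^ (1 / 2 : ℝ) * (∫⁻ a, q a ∂μ) ^ (1 / 2 : ℝ) :=
        ENNReal.lintegral_mul_norm_pow_le (by fun_prop) (by fun_prop) (by norm_num) (by norm_num)
          (by norm_num)
    _ = (∫⁻ a, u a ^ 2 ∂(μ.withDensity p)) ^ (1 / 2 : ℝ) := by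
        rw [hq_one, ENNReal.one_rpow, mul_one,
          lintegral_withDensity_eq_lintegral_mul _ hp (by fun_prop)]
        rfl

theorem sq_mul_affinity_le {μ : Measure α} {p q u v : α → ℝ≥0∞} (hp : Measurable p)
    (hq : Measurable q) (hu : Measurable u) (hv : Measurable v)
    [IsProbabilityMeasure (μ.withDensity p)] [IsProbabilityMeasure (μ.withDensity q)]
    {c : ℝ≥0∞} (hc : ∀ a, c ≤ u a + v a) :
    (c * affinity μ p q) ^ 2 ≤
      2 * (∫⁻ a, u a ^ 2 ∂(μ.withDensity p) + ∫⁻ a, v a ^ 2 ∂(μ.withDensity q)) := by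
  set A := ∫⁻ a, u a ^ 2 ∂(μ.withDensity p)
  set B := ∫⁻ a, v a ^ 2 ∂(μ.withDensity q)
  have affinity_le : c * affinity μ p q ≤ A ^ (1 / 2 : ℝ) + B ^ (1 / 2 : ℝ) :=
    calc c * affinity μ p q
        = ∫⁻ a, c * (p a * q a) ^ (1 / 2 : ℝ) ∂μ := (lintegral_const_mul _ (by fun_prop)).symm
      _ ≤ ∫⁻ a, (u a + v a) * (p a * q a) ^ (1 / 2 : ℝ) ∂μ := by gcongr with a; exact hc a
      _ = ∫⁻ a, u a * (p a * q a) ^ (1 / 2 : ℝ) ∂μ + ∫⁻ a, v a * (q a * p a) ^ (1 / 2 : ℝ) ∂μ := by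
          simp only [mul_comm (q _), add_mul]
          exact lintegral_add_left (by fun_prop) _
      _ ≤ A ^ (1 / 2 : ℝ) + B ^ (1 / 2 : ℝ) :=
          add_le_add (lintegral_mul_sqrt_le hp hq hu) (lintegral_mul_sqrt_le hq hp hv)
  calc (c * affinity μ p q) ^ 2
      ≤ (A ^ (1 / 2 : ℝ) + B ^ (1 / 2 : ℝ)) ^ (2 : ℝ) := by
        rw [ENNReal.rpow_two]; gcongr
    _ ≤ 2 ^ (2 - 1 : ℝ) * ((A ^ (1 / 2 : ℝ)) ^ (2 : ℝ) + (B ^ (1 / 2 : ℝ)) ^ (2 : ℝ)) :=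
        ENNReal.rpow_add_le_mul_rpow_add_rpow _ _ (by norm_num)
    _ = 2 * (A + B) := by
        rw [← ENNReal.rpow_mul, ← ENNReal.rpow_mul]
        norm_num

theorem two_mul_sq_affinity_le {μ : Measure α} {p q : α → ℝ≥0∞} (hp : Measurable p)
    (hq : Measurable q) [IsProbabilityMeasure (μ.withDensity p)]
    [IsProbabilityMeasure (μ.withDensity q)] {g : α → ℝ} (hg : Measurable g) {ε : ℝ} (hε : 0 ≤ ε) :
    2 * (ENNReal.ofReal (ε ^ 2) * affinity μ p q ^ 2) ≤
      ∫⁻ a, ENNReal.ofReal ((g a - ε) ^ 2) ∂(μ.withDensity p) +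
      ∫⁻ a, ENNReal.ofReal ((g a + ε) ^ 2) ∂(μ.withDensity q) := by
  have ofReal_abs_sq (t : ℝ) : ENNReal.ofReal |t| ^ 2 = ENNReal.ofReal (t ^ 2) := by
    rw [← ENNReal.ofReal_pow (abs_nonneg t), sq_abs]
  have separation (a : α) :
      ENNReal.ofReal (2 * ε) ≤ ENNReal.ofReal |g a - ε| + ENNReal.ofReal |g a + ε| := by
    rw [← ENNReal.ofReal_add (abs_nonneg _) (abs_nonneg _)]
    exact ENNReal.ofReal_le_ofReal (by linarith [neg_abs_le (g a - ε), le_abs_self (g a + ε)])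
  have h := sq_mul_affinity_le (μ := μ) hp hq (by fun_prop) (by fun_prop) separation
  simp only [ofReal_abs_sq] at h
  refine (ENNReal.mul_le_mul_iff_right two_ne_zero ENNReal.ofNat_ne_top).1 (h.trans' (le_of_eq ?_))
  rw [mul_pow, ← ENNReal.ofReal_pow (by positivity), mul_pow, ENNReal.ofReal_mul (by norm_num)]
  norm_num
  ring

/-- Le Cam's two-point bound. The observations are `φ aᵢ`; revealing the latent `aᵢ` only makes
estimation easier, so the affinity of the laws of the `aᵢ` may be used. -/
theorem two_mul_sq_affinity_pow_le {ι : Type*} [Fintype ι] {μ : Measure α} [SigmaFinite μ]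
    {p q : α → ℝ≥0∞} (hp : Measurable p) (hq : Measurable q)
    [IsProbabilityMeasure (μ.withDensity p)] [IsProbabilityMeasure (μ.withDensity q)]
    {φ : α → β} (hφ : Measurable φ) {g : (ι → β) → ℝ} (hg : Measurable g) {ε : ℝ} (hε : 0 ≤ ε) :
    2 * (ENNReal.ofReal (ε ^ 2) * (affinity μ p q ^ Fintype.card ι) ^ 2) ≤
      ∫⁻ y, ENNReal.ofReal ((g y - ε) ^ 2) ∂(Measure.pi fun _ => (μ.withDensity p).map φ) +
      ∫⁻ y, ENNReal.ofReal ((g y + ε) ^ 2) ∂(Measure.pi fun _ => (μ.withDensity q).map φ) := by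
  have pi_map (f : α → ℝ≥0∞) (hf : Measurable f) [IsProbabilityMeasure (μ.withDensity f)] :
      (Measure.pi fun _ : ι => (μ.withDensity f).map φ) =
        ((Measure.pi fun _ => μ).withDensity fun x => ∏ i, f (x i)).map fun x i => φ (x i) := by
    have := Measure.isProbabilityMeasure_map (μ := μ.withDensity f) hφ.aemeasurable
    rw [← pi_withDensity _ fun _ => hf, Measure.pi_map_pi fun _ => hφ.aemeasurable]
  have isProb (f : α → ℝ≥0∞) (hf : Measurable f) [IsProbabilityMeasure (μ.withDensity f)] :
      IsProbabilityMeasure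
        ((Measure.pi fun _ : ι => μ).withDensity fun x => ∏ i, f (x i)) := by
    rw [← pi_withDensity _ fun _ => hf]
    infer_instance
  have := isProb p hp
  have := isProb q hq
  have h := two_mul_sq_affinity_le (μ := Measure.pi fun _ : ι => μ)
    (p := fun x => ∏ i, p (x i)) (q := fun x => ∏ i, q (x i)) (by fun_prop) (by fun_prop)
    (g := fun x => g fun i => φ (x i)) (by fun_prop) hε
  rw [affinity_pi μ (fun _ => hp) fun _ => hq, Finset.prod_const, Finset.card_univ] at h
  rwa [pi_map p hp, pi_map q hq, lintegral_map (by fun_prop) (by fun_prop),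
    lintegral_map (by fun_prop) (by fun_prop)]

theorem affinity_gaussianPDF (a b : ℝ) {v : ℝ≥0} (hv : v ≠ 0) :
    affinity volume (gaussianPDF a v) (gaussianPDF b v) =
      ENNReal.ofReal (Real.exp (-((a - b) ^ 2 / (8 * v)))) := by
  have hv' : (v : ℝ) ≠ 0 := by exact_mod_cast hv
  have mul_eq_sq (y : ℝ) : gaussianPDFReal a v y * gaussianPDFReal b v y =
      (Real.exp (-((a - b) ^ 2 / (8 * v))) * gaussianPDFReal ((a + b) / 2) v y) ^ 2 := by
    have exponents : -(y - a) ^ 2 / (2 * v) + -(y - b) ^ 2 / (2 * v) =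
        2 * (-((a - b) ^ 2 / (8 * v)) + -(y - (a + b) / 2) ^ 2 / (2 * v)) := by
      field_simp
      ring
    simp only [gaussianPDFReal]
    rw [mul_mul_mul_comm, ← Real.exp_add, exponents, mul_left_comm, mul_pow, ← Real.exp_add,
      ← Real.exp_nat_mul, Nat.cast_two, sq (√(2 * Real.pi * v))⁻¹]
  have sqrt_mul (y : ℝ) : (gaussianPDF a v y * gaussianPDF b v y) ^ (1 / 2 : ℝ) =
      ENNReal.ofReal (Real.exp (-((a - b) ^ 2 / (8 * v)))) * gaussianPDF ((a + b) / 2) v y := by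
    have nonneg : 0 ≤ Real.exp (-((a - b) ^ 2 / (8 * v))) * gaussianPDFReal ((a + b) / 2) v y :=
      mul_nonneg (Real.exp_nonneg _) (gaussianPDFReal_nonneg _ _ _)
    simp only [gaussianPDF]
    rw [← ENNReal.ofReal_mul (gaussianPDFReal_nonneg _ _ _), mul_eq_sq,
      ENNReal.ofReal_rpow_of_nonneg (sq_nonneg _) (by norm_num), ← Real.sqrt_eq_rpow,
      Real.sqrt_sq nonneg, ENNReal.ofReal_mul (Real.exp_nonneg _)]
  simp_rw [affinity, sqrt_mul]
  rw [lintegral_const_mul _ (measurable_gaussianPDF _ _), lintegral_gaussianPDF_eq_one _ hv,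
    mul_one]

end Affinity

section Observation

variable {m p : ℕ}

/-- The density of the law of `a + n`, where `n ∼ noiseLaw m σ`. -/
def noisePDF (σ : ℝ≥0) (a y : Fin m → ℝ) : ℝ≥0∞ := ∏ j, gaussianPDF (a j) (σ ^ 2) (y j)

theorem measurable_noisePDF (σ : ℝ≥0) :
    Measurable fun w : (Fin m → ℝ) × (Fin m → ℝ) => noisePDF σ w.1 w.2 := by
  refine Finset.measurable_prod _ fun j _ => ?_
  exact measurable_uncurry_gaussianPDF.comp (f := fun w : (Fin m → ℝ) × (Fin m → ℝ) =>
    (w.1 j, σ ^ 2, w.2 j)) (by fun_prop)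

theorem map_add_noiseLaw {σ : ℝ≥0} (hσ : 0 < σ) (a : Fin m → ℝ) :
    (noiseLaw m σ).map (a + ·) = volume.withDensity (noisePDF σ a) := by
  have withDensity_eq (j : Fin m) : volume.withDensity (gaussianPDF (a j) (σ ^ 2)) =
      (gaussianReal 0 (σ ^ 2)).map (a j + ·) := by
    rw [gaussianReal_map_const_add, zero_add, gaussianReal_of_var_ne_zero _ (pow_pos hσ 2).ne']
  have sigmaFinite (j : Fin m) :
      SigmaFinite (volume.withDensity (gaussianPDF (a j) (σ ^ 2))) := by
    rw [withDensity_eq, gaussianReal_map_const_add]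
    infer_instance
  have h := pi_withDensity (fun _ : Fin m => (volume : Measure ℝ))
    fun j => measurable_gaussianPDF (a j) (σ ^ 2)
  simp only [withDensity_eq] at h
  rwa [← Measure.pi_map_pi fun j => (measurable_const_add (a j)).aemeasurable] at h

theorem affinity_noisePDF {σ : ℝ≥0} (hσ : 0 < σ) (a b : Fin m → ℝ) :
    affinity volume (noisePDF σ a) (noisePDF σ b) =
      ENNReal.ofReal (Real.exp (-(sqNorm (a - b) / (8 * σ ^ 2)))) := by
  have h := affinity_pi volume (fun j => measurable_gaussianPDF (a j) (σ ^ 2))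
    fun j => measurable_gaussianPDF (b j) (σ ^ 2)
  simp only [affinity_gaussianPDF _ _ (pow_pos hσ 2).ne'] at h
  rw [← ENNReal.ofReal_prod_of_nonneg fun _ _ => Real.exp_nonneg _, ← Real.exp_sum,
    Finset.sum_neg_distrib, ← Finset.sum_div] at h
  simp only [NNReal.coe_pow] at h
  exact h

/-- The density of the joint law of `(x, D x + n)`, where `x ∼ μx` and `n ∼ noiseLaw m σ` are
independent, with respect to the product of `μx` and Lebesgue measure. -/
def jointPDF (σ : ℝ≥0) (D : Matrix (Fin m) (Fin p) ℝ) (w : (Fin p → ℝ) × (Fin m → ℝ)) : ℝ≥0∞ :=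
  noisePDF σ (D.mulVec w.1) w.2

theorem measurable_mulVec (D : Matrix (Fin m) (Fin p) ℝ) : Measurable D.mulVec :=
  (Continuous.matrix_mulVec continuous_const continuous_id).measurable

theorem measurable_jointPDF (σ : ℝ≥0) (D : Matrix (Fin m) (Fin p) ℝ) :
    Measurable (jointPDF σ D) := by
  have hD := measurable_mulVec D
  exact (measurable_noisePDF σ).comp (f := fun w : (Fin p → ℝ) × (Fin m → ℝ) =>
    (D.mulVec w.1, w.2)) (by fun_prop)

instance (m : ℕ) (σ : ℝ≥0) : IsProbabilityMeasure (noiseLaw m σ) :=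
  inferInstanceAs (IsProbabilityMeasure (Measure.pi _))

theorem obsLaw_eq_map_snd (μx : Measure (Fin p → ℝ)) [SFinite μx]
    {σ : ℝ≥0} (hσ : 0 < σ) (D : Matrix (Fin m) (Fin p) ℝ) :
    obsLaw μx σ D = ((μx.prod volume).withDensity (jointPDF σ D)).map Prod.snd := by
  have hD := measurable_mulVec D
  have hpdf := measurable_jointPDF σ D
  refine Measure.ext_of_lintegral _ fun f hf => ?_
  rw [obsLaw, lintegral_map hf (by fun_prop), lintegral_map hf measurable_snd,
    lintegral_withDensity_eq_lintegral_mul _ hpdf (by fun_prop),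
    lintegral_prod _ (by fun_prop), lintegral_prod _ (by fun_prop)]
  refine lintegral_congr fun x => ?_
  calc ∫⁻ n, f (D.mulVec x + n) ∂(noiseLaw m σ)
      = ∫⁻ y, f y ∂(volume.withDensity (noisePDF σ (D.mulVec x))) := by
        rw [← map_add_noiseLaw hσ, lintegral_map hf (by fun_prop)]
    _ = ∫⁻ y, (jointPDF σ D * fun w : (Fin p → ℝ) × (Fin m → ℝ) => f w.2) (x, y) :=
        lintegral_withDensity_eq_lintegral_mul _ (hpdf.comp measurable_prodMk_left) hf

instance (μx : Measure (Fin p → ℝ)) [IsProbabilityMeasure μx] (σ : ℝ≥0)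
    (D : Matrix (Fin m) (Fin p) ℝ) : IsProbabilityMeasure (obsLaw μx σ D) :=
  have hD := measurable_mulVec D
  Measure.isProbabilityMeasure_map (by fun_prop)

theorem isProbabilityMeasure_withDensity_jointPDF (μx : Measure (Fin p → ℝ))
    [IsProbabilityMeasure μx] {σ : ℝ≥0} (hσ : 0 < σ) (D : Matrix (Fin m) (Fin p) ℝ) :
    IsProbabilityMeasure ((μx.prod volume).withDensity (jointPDF σ D)) := by
  rw [← Measure.isProbabilityMeasure_map_iff (f := Prod.snd) measurable_snd.aemeasurable,
    ← obsLaw_eq_map_snd μx hσ D]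
  infer_instance

theorem affinity_jointPDF (μx : Measure (Fin p → ℝ)) [SFinite μx] {σ : ℝ≥0} (hσ : 0 < σ)
    (D D' : Matrix (Fin m) (Fin p) ℝ) :
    affinity (μx.prod volume) (jointPDF σ D) (jointPDF σ D') =
      ∫⁻ x, ENNReal.ofReal (Real.exp (-(sqNorm ((D - D').mulVec x) / (8 * σ ^ 2)))) ∂μx := by
  have hD := measurable_jointPDF σ D
  have hD' := measurable_jointPDF σ D'
  rw [affinity, lintegral_prod _ (by fun_prop)]
  refine lintegral_congr fun x => ?_
  rw [Matrix.sub_mulVec, ← affinity_noisePDF hσ]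
  rfl

end Observation

section Moments

variable {m p s : ℕ} {c σa : ℝ} {μx : Measure (Fin p → ℝ)}

/-- `μx` is the law of a random vector `x` with `E {x xᵀ} = c I`. -/
structure HasScalarSecondMoment (c : ℝ) (μx : Measure (Fin p → ℝ)) : Prop where
  memLp_two : ∀ i, MemLp (fun x : Fin p → ℝ => x i) 2 μx
  integral_mul : ∀ i j, ∫ x, x i * x j ∂μx = if i = j then c else 0

theorem HasScalarSecondMoment.nonneg (h : HasScalarSecondMoment c μx) (k : Fin p) : 0 ≤ c := by
  have hk := h.integral_mul k k
  rw [if_pos rfl] at hk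
  exact hk ▸ integral_nonneg fun x => mul_self_nonneg (x k)

theorem HasScalarSecondMoment.integrable_const_mul_mul (h : HasScalarSecondMoment c μx) (a : ℝ)
    (i j : Fin p) : Integrable (fun x : Fin p → ℝ => a * (x i * x j)) μx :=
  ((h.memLp_two i).integrable_mul (h.memLp_two j)).const_mul a

theorem sqNorm_mulVec (A : Matrix (Fin m) (Fin p) ℝ) (x : Fin p → ℝ) :
    sqNorm (A.mulVec x) = ∑ i, ∑ k, ∑ l, A i k * A i l * (x k * x l) := by
  simp only [sqNorm, Matrix.mulVec, dotProduct, sq, Finset.sum_mul_sum, mul_mul_mul_comm]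

theorem HasScalarSecondMoment.integrable_sqNorm_mulVec (h : HasScalarSecondMoment c μx)
    (A : Matrix (Fin m) (Fin p) ℝ) : Integrable (fun x => sqNorm (A.mulVec x)) μx := by
  simp only [sqNorm_mulVec]
  exact integrable_finsetSum _ fun i _ => integrable_finsetSum _ fun k _ =>
    integrable_finsetSum _ fun l _ => h.integrable_const_mul_mul _ k l

theorem frobenius_norm_sq (A : Matrix (Fin m) (Fin p) ℝ) : ‖A‖ ^ 2 = ∑ i, ∑ k, A i k ^ 2 := by
  rw [Matrix.frobenius_norm_def, ← Real.sqrt_eq_rpow, Real.sq_sqrt (by positivity)]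
  simp only [Real.rpow_two, Real.norm_eq_abs, sq_abs]

theorem HasScalarSecondMoment.integral_sqNorm_mulVec (h : HasScalarSecondMoment c μx)
    (A : Matrix (Fin m) (Fin p) ℝ) : ∫ x, sqNorm (A.mulVec x) ∂μx = c * ‖A‖ ^ 2 := by
  simp only [sqNorm_mulVec, frobenius_norm_sq, Finset.mul_sum]
  rw [integral_finsetSum _ fun i _ => integrable_finsetSum _ fun k _ =>
    integrable_finsetSum _ fun l _ => h.integrable_const_mul_mul _ k l]
  refine Finset.sum_congr rfl fun i _ => ?_
  rw [integral_finsetSum _ fun k _ => integrable_finsetSum _ fun l _ =>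
    h.integrable_const_mul_mul _ k l]
  refine Finset.sum_congr rfl fun k _ => ?_
  rw [integral_finsetSum _ fun l _ => h.integrable_const_mul_mul _ k l]
  simp only [integral_const_mul, h.integral_mul, mul_ite, mul_zero, Finset.sum_ite_eq,
    Finset.mem_univ, if_true]
  ring

theorem integral_sqNorm_noiseLaw (m : ℕ) (σ : ℝ≥0) :
    ∫ n, sqNorm n ∂(noiseLaw m σ) = m * (σ : ℝ) ^ 2 := by
  have second_moment : ∫ t, t ^ 2 ∂(gaussianReal 0 (σ ^ 2)) = (σ : ℝ) ^ 2 := by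
    have h := variance_id_gaussianReal (μ := 0) (v := σ ^ 2)
    rw [variance_of_integral_eq_zero (by fun_prop) (by simp)] at h
    simpa using h
  have integrable_sq : Integrable (fun t : ℝ => t ^ 2) (gaussianReal 0 (σ ^ 2)) :=
    (memLp_id_gaussianReal 2).integrable_sq
  simp only [sqNorm, noiseLaw]
  rw [integral_finsetSum _ fun i _ => integrable_comp_eval (μ := fun _ : Fin m =>
      gaussianReal 0 (σ ^ 2)) (i := i) integrable_sq,
    Finset.sum_congr rfl fun i _ => (integral_comp_eval (μ := fun _ : Fin m =>
      gaussianReal 0 (σ ^ 2)) (i := i) integrable_sq.aestronglyMeasurable).trans second_moment]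
  simp

theorem mem_dictionaries_iff {D : Matrix (Fin m) (Fin p) ℝ} :
    D ∈ dictionaries m p ↔ ∀ k, ∑ i, D i k ^ 2 = 1 := by
  simp only [dictionaries, Set.mem_ofPred_eq, Matrix.mul_apply, Matrix.transpose_apply, sq]

theorem norm_sq_of_mem_dictionaries {D : Matrix (Fin m) (Fin p) ℝ} (hD : D ∈ dictionaries m p) :
    ‖D‖ ^ 2 = p := by
  rw [frobenius_norm_sq, Finset.sum_comm,
    Finset.sum_congr rfl fun k _ => mem_dictionaries_iff.1 hD k]
  simp

theorem HasScalarSecondMoment.SNR_eq (h : HasScalarSecondMoment c μx) (σ : ℝ≥0)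
    {D : Matrix (Fin m) (Fin p) ℝ} (hD : D ∈ dictionaries m p) :
    SNR μx σ D = c * p / (m * σ ^ 2) := by
  rw [SNR, h.integral_sqNorm_mulVec, integral_sqNorm_noiseLaw, norm_sq_of_mem_dictionaries hD]

theorem SNR_nonneg (μx : Measure (Fin p → ℝ)) (σ : ℝ≥0) (D : Matrix (Fin m) (Fin p) ℝ) :
    0 ≤ SNR μx σ D :=
  div_nonneg (integral_nonneg fun _ => Finset.sum_nonneg fun _ _ => sq_nonneg _)
    (integral_nonneg fun _ => Finset.sum_nonneg fun _ _ => sq_nonneg _)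

theorem HasScalarSecondMoment.le_affinity_jointPDF [IsProbabilityMeasure μx]
    (h : HasScalarSecondMoment c μx) {σ : ℝ≥0} (hσ : 0 < σ) (D D' : Matrix (Fin m) (Fin p) ℝ) :
    ENNReal.ofReal (Real.exp (-(c * ‖D - D'‖ ^ 2 / (8 * σ ^ 2)))) ≤
      affinity (μx.prod volume) (jointPDF σ D) (jointPDF σ D') := by
  let X (x : Fin p → ℝ) : ℝ := -(sqNorm ((D - D').mulVec x) / (8 * σ ^ 2))
  have X_nonpos (x : Fin p → ℝ) : X x ≤ 0 :=
    neg_nonpos.2 (div_nonneg (Finset.sum_nonneg fun _ _ => sq_nonneg _) (by positivity))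
  have integrable_X : Integrable X μx := ((h.integrable_sqNorm_mulVec _).div_const _).neg
  have integrable_exp : Integrable (fun x => Real.exp (X x)) μx := by
    refine (integrable_const (1 : ℝ)).mono'
      (Real.continuous_exp.comp_aestronglyMeasurable integrable_X.aestronglyMeasurable)
      (ae_of_all _ fun x => ?_)
    rw [Real.norm_eq_abs, Real.abs_exp]
    exact Real.exp_le_one_iff.2 (X_nonpos x)
  have jensen : Real.exp (∫ x, X x ∂μx) ≤ ∫ x, Real.exp (X x) ∂μx :=
    convexOn_exp.map_integral_le Real.continuous_exp.continuousOn isClosed_univ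
      (ae_of_all _ fun _ => Set.mem_univ _) integrable_X integrable_exp
  rw [integral_neg, integral_div, h.integral_sqNorm_mulVec] at jensen
  rw [affinity_jointPDF μx hσ, ← ofReal_integral_eq_lintegral_ofReal integrable_exp
    (ae_of_all _ fun x => Real.exp_nonneg _)]
  exact ENNReal.ofReal_le_ofReal jensen

end Moments

section SparseCoefficients

variable {p s : ℕ} {σa : ℝ} {μx : Measure (Fin p → ℝ)}

theorem measurableSet_supp_eq (S : Finset (Fin p)) :
    MeasurableSet {x : Fin p → ℝ | supp x = S} := by
  have setOf_eq : {x : Fin p → ℝ | supp x = S} = ⋂ i, {x | x i ≠ 0 ↔ i ∈ S} := by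
    ext x
    simp [Finset.ext_iff, supp]
  have measurableSet_ne (i : Fin p) : MeasurableSet {x : Fin p → ℝ | x i ≠ 0} :=
    (measurableSet_eq_fun (measurable_pi_apply i) measurable_const).compl
  rw [setOf_eq]
  exact .iInter fun i => (measurableSet_ne i).iff (.const _)

theorem pairwiseDisjoint_supp_eq (T : Set (Finset (Fin p))) :
    T.PairwiseDisjoint fun S => {x : Fin p → ℝ | supp x = S} :=
  fun _ _ _ _ hne => Set.disjoint_left.2 fun _ hx hx' => hne (hx.symm.trans hx')

theorem card_filter_mem_powersetCard {α : Type*} [Fintype α] [DecidableEq α] (s : ℕ) (i : α) :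
    ((Finset.univ.powersetCard s).filter (i ∈ ·)).card * Fintype.card α =
      (Fintype.card α).choose s * s := by
  obtain ⟨q, hq⟩ := Nat.exists_eq_succ_of_ne_zero (Fintype.card_pos_iff.2 ⟨i⟩).ne'
  cases s with
  | zero => simp
  | succ t =>
    have h := Finset.card_filter_powersetCard_subset {i} Finset.univ (t + 1)
      (Finset.subset_univ _) (by simp)
    simp only [Finset.singleton_subset_iff, Finset.card_univ, Finset.card_singleton] at h
    rw [h, hq, Nat.succ_eq_add_one, ← Nat.add_one_mul_choose_eq, mul_comm,
      Nat.add_sub_cancel, Nat.add_sub_cancel]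

theorem IsSparseCoeffLaw.ae_card_supp [IsProbabilityMeasure μx] (h : IsSparseCoeffLaw s σa μx)
    (hsp : s ≤ p) : ∀ᵐ x ∂μx, (supp x).card = s := by
  have real_eq_one :
      μx.real (⋃ S ∈ Finset.univ.powersetCard s, {x : Fin p → ℝ | supp x = S}) = 1 := by
    rw [measureReal_biUnion_finset (pairwiseDisjoint_supp_eq _) fun S _ => measurableSet_supp_eq S,
      Finset.sum_congr rfl fun S hS => h.supp_uniform S (Finset.mem_powersetCard.1 hS).2]
    simp [(Nat.choose_pos hsp).ne']
  rw [measureReal_def, ENNReal.toReal_eq_one_iff, ← mem_ae_iff_prob_eq_one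
    (Finset.measurableSet_biUnion _ fun S _ => measurableSet_supp_eq S)] at real_eq_one
  filter_upwards [real_eq_one] with x hx
  simpa using hx

theorem IsSparseCoeffLaw.setIntegral_mul (h : IsSparseCoeffLaw s σa μx)
    (hsp : s ≤ p) {S : Finset (Fin p)} (hS : S.card = s) (i j : Fin p) :
    ∫ x in {x | supp x = S}, x i * x j ∂μx =
      if i ∈ S ∧ i = j then 1 / (p.choose s : ℝ) * σa ^ 2 else 0 := by
  have choose_pos : (0 : ℝ) < p.choose s := by exact_mod_cast Nat.choose_pos hsp
  by_cases hij : i ∈ S ∧ j ∈ S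
  · have h_cond := h.cond_cov S hS i hij.1 j hij.2
    rw [ProbabilityTheory.cond, integral_smul_measure, ENNReal.toReal_inv, ← measureReal_def,
      h.supp_uniform S hS, one_div, inv_inv, smul_eq_mul] at h_cond
    rw [eq_div_of_mul_eq choose_pos.ne' ((mul_comm _ _).trans h_cond)]
    simp only [hij.1, true_and]
    split_ifs <;> ring
  · rw [if_neg fun hi : i ∈ S ∧ i = j => hij ⟨hi.1, hi.2 ▸ hi.1⟩]
    refine setIntegral_eq_zero_of_forall_eq_zero fun x (hx : supp x = S) => ?_
    subst hx
    by_contra hne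
    exact hij (by simpa [supp] using hne)

theorem IsSparseCoeffLaw.integral_mul [IsProbabilityMeasure μx] (h : IsSparseCoeffLaw s σa μx)
    (hsp : s ≤ p) (i j : Fin p) :
    ∫ x, x i * x j ∂μx = if i = j then (s : ℝ) / p * σa ^ 2 else 0 := by
  have choose_pos : (0 : ℝ) < p.choose s := by exact_mod_cast Nat.choose_pos hsp
  have p_pos : (0 : ℝ) < p := by exact_mod_cast i.pos
  have integrable : Integrable (fun x : Fin p → ℝ => x i * x j) μx :=
    (h.memLp_two i).integrable_mul (h.memLp_two j)
  have sum_over_supports : ∫ x, x i * x j ∂μx =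
      ∑ S ∈ Finset.univ.powersetCard s, ∫ x in {x | supp x = S}, x i * x j ∂μx := by
    rw [← integral_biUnion_finset _ (fun S _ => measurableSet_supp_eq S)
      (pairwiseDisjoint_supp_eq _) fun S _ => integrable.integrableOn,
      setIntegral_eq_integral_of_ae_compl_eq_zero]
    filter_upwards [h.ae_card_supp hsp] with x hx hx'
    simp [hx] at hx'
  rw [sum_over_supports, Finset.sum_congr rfl fun S hS =>
    h.setIntegral_mul hsp (Finset.mem_powersetCard.1 hS).2 i j]
  by_cases hij : i = j
  · have card_mul : (((Finset.univ.powersetCard s).filter (i ∈ ·)).card : ℝ) * p =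
        p.choose s * s := by
      exact_mod_cast Fintype.card_fin p ▸ card_filter_mem_powersetCard s i
    simp only [hij, and_true, if_true]
    rw [← Finset.sum_filter, Finset.sum_const, nsmul_eq_mul]
    rw [hij] at card_mul
    field_simp
    linear_combination σa ^ 2 * card_mul
  · simp [hij]

theorem IsSparseCoeffLaw.hasScalarSecondMoment [IsProbabilityMeasure μx]
    (h : IsSparseCoeffLaw s σa μx) (hsp : s ≤ p) :
    HasScalarSecondMoment ((s : ℝ) / p * σa ^ 2) μx :=
  ⟨h.memLp_two, h.integral_mul hsp⟩

end SparseCoefficients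

section Hypercube

/-- The sign `±1` encoded by a Boolean. -/
def boolSign (b : Bool) : ℝ := if b then 1 else -1

theorem boolSign_sq (b : Bool) : boolSign b ^ 2 = 1 := by cases b <;> simp [boolSign]

theorem sqNorm_eq_dotProduct {n : ℕ} (v : Fin n → ℝ) : sqNorm v = dotProduct v v := by
  simp only [sqNorm, dotProduct, sq]

theorem sqNorm_orthogonal_mulVec {n : ℕ} (U : Matrix.orthogonalGroup (Fin n) ℝ)
    (v : Fin n → ℝ) : sqNorm (U.1.mulVec v) = sqNorm v := by
  have hU : U.1.transpose * U.1 = 1 := Matrix.UnitaryGroup.star_mul_self U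
  rw [sqNorm_eq_dotProduct, sqNorm_eq_dotProduct, Matrix.dotProduct_mulVec,
    ← Matrix.mulVec_transpose, Matrix.mulVec_mulVec, hU, Matrix.one_mulVec]

theorem exists_orthogonal_mulVec_eq_single {ι : Type*} [Fintype ι] [DecidableEq ι] (i₀ : ι)
    {u : ι → ℝ} (hu : ∑ i, u i ^ 2 = 1) :
    ∃ U : Matrix.orthogonalGroup ι ℝ, U.1.mulVec u = Pi.single i₀ 1 := by
  have orthonormal : Orthonormal ℝ (({i₀} : Set ι).domRestrict
      fun _ => (WithLp.toLp 2 u : EuclideanSpace ℝ ι)) := by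
    refine ⟨fun i => ?_, fun i j hij => absurd (Subsingleton.elim i j) hij⟩
    simp [EuclideanSpace.norm_eq, hu]
  obtain ⟨b, hb⟩ := orthonormal.exists_orthonormalBasis_extension_of_card_eq (by simp)
  have sum_mul (j l : ι) : ∑ i, b j i * b l i = if j = l then 1 else 0 := by
    have h := orthonormal_iff_ite.1 b.orthonormal l j
    simpa only [PiLp.inner_apply, RCLike.inner_apply, conj_trivial, eq_comm] using h
  refine ⟨⟨Matrix.of fun j i => b j i, (Matrix.mem_orthogonalGroup_iff _ _).2 ?_⟩, ?_⟩
  · ext j l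
    simpa [Matrix.mul_apply, Matrix.one_apply] using sum_mul j l
  · ext j
    have h := sum_mul j i₀
    rw [hb i₀ rfl] at h
    simpa [Matrix.mulVec, dotProduct, Pi.single_apply] using h

variable {n p : ℕ}

/-- The matrix with the columns `U k *ᵥ aₖ`, where `aₖ` are the columns of `A`. -/
def rotateCols (U : Fin p → Matrix.orthogonalGroup (Fin n) ℝ) (A : Matrix (Fin n) (Fin p) ℝ) :
    Matrix (Fin n) (Fin p) ℝ :=
  Matrix.of fun i k => (U k).1.mulVec (A.col k) i

theorem col_rotateCols (U : Fin p → Matrix.orthogonalGroup (Fin n) ℝ)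
    (A : Matrix (Fin n) (Fin p) ℝ) (k : Fin p) :
    (rotateCols U A).col k = (U k).1.mulVec (A.col k) := rfl

theorem rotateCols_rotateCols_inv (U : Fin p → Matrix.orthogonalGroup (Fin n) ℝ)
    (A : Matrix (Fin n) (Fin p) ℝ) : rotateCols U (rotateCols U⁻¹ A) = A := by
  refine Matrix.ext_col fun k => ?_
  have mul_inv : (U k).1 * (U⁻¹ k).1 = 1 := Unitary.mul_star_self_of_mem (U k).2
  rw [col_rotateCols, col_rotateCols, Matrix.mulVec_mulVec, mul_inv, Matrix.one_mulVec]

theorem rotateCols_sub (U : Fin p → Matrix.orthogonalGroup (Fin n) ℝ)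
    (A B : Matrix (Fin n) (Fin p) ℝ) :
    rotateCols U (A - B) = rotateCols U A - rotateCols U B :=
  Matrix.ext_col fun k => (U k).1.mulVec_sub (A.col k) (B.col k)

theorem rotateCols_mem_dictionaries (U : Fin p → Matrix.orthogonalGroup (Fin n) ℝ)
    {A : Matrix (Fin n) (Fin p) ℝ} (hA : A ∈ dictionaries n p) :
    rotateCols U A ∈ dictionaries n p :=
  mem_dictionaries_iff.2 fun k =>
    (sqNorm_orthogonal_mulVec (U k) (A.col k)).trans (mem_dictionaries_iff.1 hA k)

theorem norm_rotateCols (U : Fin p → Matrix.orthogonalGroup (Fin n) ℝ)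
    (A : Matrix (Fin n) (Fin p) ℝ) : ‖rotateCols U A‖ = ‖A‖ := by
  refine (sq_eq_sq₀ (norm_nonneg _) (norm_nonneg _)).1 ?_
  rw [frobenius_norm_sq, frobenius_norm_sq, Finset.sum_comm,
    Finset.sum_comm (f := fun i k => A i k ^ 2)]
  exact Finset.sum_congr rfl fun k _ => sqNorm_orthogonal_mulVec (U k) (A.col k)

theorem norm_sub_rotateCols_inv (U : Fin p → Matrix.orthogonalGroup (Fin n) ℝ)
    (A B : Matrix (Fin n) (Fin p) ℝ) : ‖A - rotateCols U⁻¹ B‖ = ‖rotateCols U A - B‖ := by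
  rw [← norm_rotateCols U, rotateCols_sub, rotateCols_rotateCols_inv]

/-- The dictionary all of whose columns are the first standard basis vector. -/
def poleDict (n p : ℕ) : Matrix (Fin (n + 1)) (Fin p) ℝ :=
  Matrix.of fun i _ => (Pi.single 0 1 : Fin (n + 1) → ℝ) i

theorem exists_rotateCols_eq_poleDict {D : Matrix (Fin (n + 1)) (Fin p) ℝ}
    (hD : D ∈ dictionaries (n + 1) p) : ∃ U, rotateCols U D = poleDict n p := by
  choose U hU using fun k => exists_orthogonal_mulVec_eq_single 0 (mem_dictionaries_iff.1 hD k)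
  exact ⟨U, Matrix.ext_col hU⟩

/-- The vertex with signs `τ` of a hypercube of dictionaries around `poleDict n p`: each of the last
`n` coordinates of each column is moved from `0` to `±ε`. -/
def signDict (ε : ℝ) (τ : Fin p × Fin n → Bool) : Matrix (Fin (n + 1)) (Fin p) ℝ :=
  Matrix.of fun i k => Fin.cases (√(1 - n * ε ^ 2)) (fun j => ε * boolSign (τ (k, j))) i

theorem frobenius_norm_sq_eq_add (A : Matrix (Fin (n + 1)) (Fin p) ℝ) :
    ‖A‖ ^ 2 = ∑ k, A 0 k ^ 2 + ∑ c : Fin p × Fin n, A c.2.succ c.1 ^ 2 := by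
  rw [frobenius_norm_sq, Fin.sum_univ_succ, Finset.sum_comm, Fintype.sum_prod_type]

variable {ε : ℝ}

theorem signDict_zero (τ : Fin p × Fin n → Bool) (k : Fin p) :
    signDict ε τ 0 k = √(1 - n * ε ^ 2) := rfl

theorem signDict_succ (τ : Fin p × Fin n → Bool) (j : Fin n) (k : Fin p) :
    signDict ε τ j.succ k = ε * boolSign (τ (k, j)) := rfl

theorem signDict_mem_dictionaries (hε : n * ε ^ 2 ≤ 1) (τ : Fin p × Fin n → Bool) :
    signDict ε τ ∈ dictionaries (n + 1) p := by
  refine mem_dictionaries_iff.2 fun k => ?_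
  simp [Fin.sum_univ_succ, signDict_zero, signDict_succ, mul_pow, boolSign_sq,
    Real.sq_sqrt (sub_nonneg.2 hε)]

theorem norm_signDict_sub_poleDict_sq_le (hε : n * ε ^ 2 ≤ 1) (τ : Fin p × Fin n → Bool) :
    ‖signDict ε τ - poleDict n p‖ ^ 2 ≤ 2 * (p * n) * ε ^ 2 := by
  have first_row : (√(1 - n * ε ^ 2) - 1) ^ 2 ≤ n * ε ^ 2 := by
    have sqrt_le_one : √(1 - n * ε ^ 2) ≤ 1 :=
      Real.sqrt_le_one.2 (sub_le_self _ (by positivity))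
    nlinarith [Real.sq_sqrt (sub_nonneg.2 hε), Real.sqrt_nonneg (1 - n * ε ^ 2)]
  have h : ‖signDict ε τ - poleDict n p‖ ^ 2 =
      p * (√(1 - n * ε ^ 2) - 1) ^ 2 + p * n * ε ^ 2 := by
    simp [frobenius_norm_sq_eq_add, signDict_zero, signDict_succ, poleDict, mul_pow, boolSign_sq]
  rw [h]
  nlinarith [mul_le_mul_of_nonneg_left first_row (Nat.cast_nonneg (α := ℝ) p)]

theorem norm_signDict_update_sub_sq (τ : Fin p × Fin n → Bool) (c : Fin p × Fin n) :
    ‖signDict ε (Function.update τ c true) - signDict ε (Function.update τ c false)‖ ^ 2 =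
      4 * ε ^ 2 := by
  have sq_sub (c' : Fin p × Fin n) : (ε * boolSign (Function.update τ c true c') -
      ε * boolSign (Function.update τ c false c')) ^ 2 = if c' = c then 4 * ε ^ 2 else 0 := by
    by_cases h : c' = c
    · simp only [h, Function.update_self, boolSign, if_true, Bool.false_eq_true, if_false]
      ring
    · simp [h]
  simp [frobenius_norm_sq_eq_add, signDict_zero, signDict_succ, sq_sub]

theorem sum_sq_le_norm_sub_signDict_sq (A : Matrix (Fin (n + 1)) (Fin p) ℝ)
    (τ : Fin p × Fin n → Bool) :
    ∑ c : Fin p × Fin n, (A c.2.succ c.1 - ε * boolSign (τ c)) ^ 2 ≤ ‖A - signDict ε τ‖ ^ 2 := by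
  rw [frobenius_norm_sq_eq_add]
  exact le_add_of_nonneg_left (by positivity)

end Hypercube

section Assouad

theorem card_mul_le_sum_of_update {ι : Type*} [Fintype ι] [DecidableEq ι]
    {F : (ι → Bool) → ℝ≥0∞} {L : ℝ≥0∞} (c : ι)
    (h : ∀ τ, 2 * L ≤ F (Function.update τ c true) + F (Function.update τ c false)) :
    Fintype.card (ι → Bool) * L ≤ ∑ τ, F τ := by
  let flip (τ : ι → Bool) : ι → Bool := Function.update τ c (!τ c)
  have flip_involutive : Function.Involutive flip := fun τ => by simp [flip]
  have two_mul_le (τ : ι → Bool) : 2 * L ≤ F τ + F (flip τ) := by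
    have hτ := Function.update_eq_self c τ
    cases hc : τ c <;> rw [hc] at hτ
    · simpa [flip, hc, hτ, add_comm] using h τ
    · simpa [flip, hc, hτ] using h τ
  refine (ENNReal.mul_le_mul_iff_right two_ne_zero ENNReal.ofNat_ne_top).1 ?_
  calc 2 * (Fintype.card (ι → Bool) * L) = ∑ _τ : ι → Bool, 2 * L := by
        rw [Finset.sum_const, nsmul_eq_mul, Finset.card_univ, mul_left_comm]
    _ ≤ ∑ τ, (F τ + F (flip τ)) := Finset.sum_le_sum fun τ _ => two_mul_le τ
    _ = 2 * ∑ τ, F τ := by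
        have sum_flip : ∑ τ, F (flip τ) = ∑ τ, F τ := Equiv.sum_comp flip_involutive.toPerm F
        rw [Finset.sum_add_distrib, sum_flip, two_mul]

/-- Assouad's lemma: the worst vertex of a hypercube is at least as bad as the average vertex, and
pairing the vertices along the edges of direction `c` bounds the average of the `c`-th loss. -/
theorem card_mul_le_of_sum_le {ι : Type*} [Fintype ι] [DecidableEq ι]
    {F : ι → (ι → Bool) → ℝ≥0∞} {L R : ℝ≥0∞}
    (hL : ∀ c τ, 2 * L ≤ F c (Function.update τ c true) + F c (Function.update τ c false))
    (hR : ∀ τ, ∑ c, F c τ ≤ R) : Fintype.card ι * L ≤ R := by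
  refine (ENNReal.mul_le_mul_iff_right (a := (Fintype.card (ι → Bool) : ℝ≥0∞))
    (by exact_mod_cast Fintype.card_ne_zero) (ENNReal.natCast_ne_top _)).1 ?_
  calc (Fintype.card (ι → Bool) : ℝ≥0∞) * (Fintype.card ι * L)
      = ∑ _c : ι, Fintype.card (ι → Bool) * L := by
        rw [Finset.sum_const, nsmul_eq_mul, Finset.card_univ, mul_left_comm]
    _ ≤ ∑ c, ∑ τ, F c τ := Finset.sum_le_sum fun c _ => card_mul_le_sum_of_update c (hL c)
    _ = ∑ τ, ∑ c, F c τ := Finset.sum_comm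
    _ ≤ ∑ _τ : ι → Bool, R := Finset.sum_le_sum fun τ _ => hR τ
    _ = Fintype.card (ι → Bool) * R := by
        rw [Finset.sum_const, nsmul_eq_mul, Finset.card_univ]

variable {m n p N : ℕ} {c : ℝ} {μx : Measure (Fin p → ℝ)} {σ : ℝ≥0} {ε r : ℝ}

theorem HasScalarSecondMoment.two_mul_le_lintegral_dataLaw [IsProbabilityMeasure μx]
    (h : HasScalarSecondMoment c μx) (hσ : 0 < σ) (D D' : Matrix (Fin m) (Fin p) ℝ)
    {g : (Fin N → Fin m → ℝ) → ℝ} (hg : Measurable g) (hε : 0 ≤ ε) :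
    2 * ENNReal.ofReal (ε ^ 2 * Real.exp (-(N * c * ‖D - D'‖ ^ 2 / (4 * σ ^ 2)))) ≤
      ∫⁻ Y, ENNReal.ofReal ((g Y - ε) ^ 2) ∂(dataLaw μx σ N D) +
      ∫⁻ Y, ENNReal.ofReal ((g Y + ε) ^ 2) ∂(dataLaw μx σ N D') := by
  have := isProbabilityMeasure_withDensity_jointPDF μx hσ D
  have := isProbabilityMeasure_withDensity_jointPDF μx hσ D'
  have exp_eq : Real.exp (-(N * c * ‖D - D'‖ ^ 2 / (4 * σ ^ 2))) =
      (Real.exp (-(c * ‖D - D'‖ ^ 2 / (8 * σ ^ 2))) ^ N) ^ 2 := by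
    rw [← Real.exp_nat_mul, ← Real.exp_nat_mul]
    congr 1
    push_cast
    ring
  calc 2 * ENNReal.ofReal (ε ^ 2 * Real.exp (-(N * c * ‖D - D'‖ ^ 2 / (4 * σ ^ 2))))
      = 2 * (ENNReal.ofReal (ε ^ 2) *
          (ENNReal.ofReal (Real.exp (-(c * ‖D - D'‖ ^ 2 / (8 * σ ^ 2)))) ^ N) ^ 2) := by
        rw [exp_eq, ENNReal.ofReal_mul (sq_nonneg ε),
          ENNReal.ofReal_pow (pow_nonneg (Real.exp_nonneg _) N),
          ENNReal.ofReal_pow (Real.exp_nonneg _)]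
    _ ≤ 2 * (ENNReal.ofReal (ε ^ 2) *
          (affinity (μx.prod volume) (jointPDF σ D) (jointPDF σ D') ^ N) ^ 2) := by
        gcongr
        exact h.le_affinity_jointPDF hσ D D'
    _ ≤ _ := by
        have le_cam := two_mul_sq_affinity_pow_le (ι := Fin N) (μ := μx.prod volume)
          (measurable_jointPDF σ D) (measurable_jointPDF σ D') measurable_snd hg hε
        rw [Fintype.card_fin, ← obsLaw_eq_map_snd μx hσ, ← obsLaw_eq_map_snd μx hσ] at le_cam
        exact le_cam

theorem measurable_rotateCols_apply (U : Fin p → Matrix.orthogonalGroup (Fin n) ℝ)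
    {α : Type*} [MeasurableSpace α] {A : α → Matrix (Fin n) (Fin p) ℝ}
    (hA : ∀ i k, Measurable fun a => A a i k) (i : Fin n) (k : Fin p) :
    Measurable fun a => rotateCols U (A a) i k := by
  change Measurable fun a => ∑ j, (U k).1 i j * A a j k
  exact Finset.measurable_sum _ fun j _ => (hA j k).const_mul _

theorem sum_lintegral_le_mse (μx : Measure (Fin p → ℝ)) (σ : ℝ≥0)
    {Dhat : (Fin N → Fin (n + 1) → ℝ) → Matrix (Fin (n + 1)) (Fin p) ℝ}
    (hDhat : ∀ i k, Measurable fun Y => Dhat Y i k)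
    (U : Fin p → Matrix.orthogonalGroup (Fin (n + 1)) ℝ) (ε : ℝ) (τ : Fin p × Fin n → Bool) :
    ∑ i : Fin p × Fin n, ∫⁻ Y, ENNReal.ofReal
        ((rotateCols U (Dhat Y) i.2.succ i.1 - ε * boolSign (τ i)) ^ 2)
          ∂(dataLaw μx σ N (rotateCols U⁻¹ (signDict ε τ))) ≤
      mse μx σ N Dhat (rotateCols U⁻¹ (signDict ε τ)) := by
  have measurable_coord := measurable_rotateCols_apply U hDhat
  rw [mse, ← lintegral_finsetSum _ fun i _ => by fun_prop]
  refine lintegral_mono fun Y => ?_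
  rw [← ENNReal.ofReal_sum_of_nonneg fun i _ => sq_nonneg _, norm_sub_rotateCols_inv]
  exact ENNReal.ofReal_le_ofReal (sum_sq_le_norm_sub_signDict_sq _ τ)

theorem rotateCols_signDict_mem_neighborhood {U : Fin p → Matrix.orthogonalGroup (Fin (n + 1)) ℝ}
    {D₀ : Matrix (Fin (n + 1)) (Fin p) ℝ} (hU : rotateCols U D₀ = poleDict n p) (hr : 0 ≤ r)
    (hε : n * ε ^ 2 ≤ 1) (hεr : 2 * (p * n) * ε ^ 2 < r ^ 2) (τ : Fin p × Fin n → Bool) :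
    rotateCols U⁻¹ (signDict ε τ) ∈ neighborhood D₀ r := by
  refine ⟨rotateCols_mem_dictionaries _ (signDict_mem_dictionaries hε τ), ?_⟩
  rw [norm_sub_rev, norm_sub_rotateCols_inv, hU, norm_sub_rev]
  exact lt_of_pow_lt_pow_left₀ 2 hr ((norm_signDict_sub_poleDict_sq_le hε τ).trans_lt hεr)

theorem HasScalarSecondMoment.le_minimaxRisk [IsProbabilityMeasure μx]
    (h : HasScalarSecondMoment c μx) (hσ : 0 < σ) {D₀ : Matrix (Fin (n + 1)) (Fin p) ℝ}
    (hD₀ : D₀ ∈ dictionaries (n + 1) p) (hr : 0 ≤ r) (hε : 0 ≤ ε) (hεn : n * ε ^ 2 ≤ 1)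
    (hεr : 2 * (p * n) * ε ^ 2 < r ^ 2) :
    ENNReal.ofReal (p * n * (ε ^ 2 * Real.exp (-(N * c * ε ^ 2 / σ ^ 2)))) ≤
      minimaxRisk μx σ N D₀ r := by
  obtain ⟨U, hU⟩ := exists_rotateCols_eq_poleDict hD₀
  refine le_iInf₂ fun Dhat hDhat => ?_
  let F (i : Fin p × Fin n) (τ : Fin p × Fin n → Bool) : ℝ≥0∞ :=
    ∫⁻ Y, ENNReal.ofReal ((rotateCols U (Dhat Y) i.2.succ i.1 - ε * boolSign (τ i)) ^ 2)
      ∂(dataLaw μx σ N (rotateCols U⁻¹ (signDict ε τ)))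
  have two_point (i : Fin p × Fin n) (τ : Fin p × Fin n → Bool) :
      2 * ENNReal.ofReal (ε ^ 2 * Real.exp (-(N * c * ε ^ 2 / σ ^ 2))) ≤
        F i (Function.update τ i true) + F i (Function.update τ i false) := by
    have le_cam := h.two_mul_le_lintegral_dataLaw (N := N) hσ
      (rotateCols U⁻¹ (signDict ε (Function.update τ i true)))
      (rotateCols U⁻¹ (signDict ε (Function.update τ i false)))
      (measurable_rotateCols_apply U hDhat i.2.succ i.1) hε
    rw [norm_sub_rotateCols_inv, rotateCols_rotateCols_inv, norm_signDict_update_sub_sq,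
      mul_left_comm, mul_div_mul_left _ _ (four_ne_zero (α := ℝ))] at le_cam
    simpa [F, boolSign] using le_cam
  have sum_le (τ : Fin p × Fin n → Bool) :
      ∑ i, F i τ ≤ ⨆ D ∈ neighborhood D₀ r, mse μx σ N Dhat D :=
    (sum_lintegral_le_mse μx σ hDhat U ε τ).trans
      (le_iSup₂ (f := fun D _ => mse μx σ N Dhat D) _
        (rotateCols_signDict_mem_neighborhood hU hr hεn hεr τ))
  have assouad := card_mul_le_of_sum_le two_point sum_le
  rw [Fintype.card_prod, Fintype.card_fin, Fintype.card_fin] at assouad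
  rwa [ENNReal.ofReal_mul (by positivity), ← Nat.cast_mul, ENNReal.ofReal_natCast]

theorem HasScalarSecondMoment.min_le_minimaxRisk [IsProbabilityMeasure μx]
    (h : HasScalarSecondMoment c μx) (hc : 0 < c) (hσ : 0 < σ) (hN : 1 ≤ N) (hn : 0 < n)
    (hp : 0 < p) {D₀ : Matrix (Fin (n + 1)) (Fin p) ℝ} (hD₀ : D₀ ∈ dictionaries (n + 1) p)
    (hr : 0 < r) (hrp : r ≤ 2 * √p) :
    ENNReal.ofReal (3 / 16 * min (r ^ 2) (p * n * (σ ^ 2 / (N * c)))) ≤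
      minimaxRisk μx σ N D₀ r := by
  set M := min (r ^ 2) (p * n * (σ ^ 2 / (N * c)))
  have : (0 : ℝ) < σ := hσ
  have : (0 : ℝ) < N := by exact_mod_cast hN
  have pn_pos : (0 : ℝ) < p * n := by positivity
  have M_pos : 0 < M := lt_min (by positivity) (by positivity)
  have M_le_sq : M ≤ r ^ 2 := min_le_left _ _
  have sq_le : r ^ 2 ≤ 4 * (p : ℝ) := by
    calc r ^ 2 ≤ (2 * √p) ^ 2 := by gcongr
      _ = 4 * (p : ℝ) := by rw [mul_pow, Real.sq_sqrt (Nat.cast_nonneg p)]; norm_num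
  -- The radius constraint allows `p n ε² < r² / 2`, while `N c ε² ≤ σ² / 4` keeps the affinities
  -- bounded below.
  obtain ⟨ε, hε, pn_mul_sq⟩ : ∃ ε : ℝ, 0 ≤ ε ∧ p * n * ε ^ 2 = M / 4 := by
    refine ⟨√(M / (4 * (p * n))), Real.sqrt_nonneg _, ?_⟩
    rw [Real.sq_sqrt (by positivity)]
    field_simp
  have sq_le_noise : ε ^ 2 ≤ σ ^ 2 / (N * c) / 4 := by
    refine le_of_mul_le_mul_left ?_ pn_pos
    linarith [min_le_right (r ^ 2) (p * n * (σ ^ 2 / (N * c)))]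
  have three_quarters_le : 3 / 4 ≤ Real.exp (-(N * c * ε ^ 2 / σ ^ 2)) := by
    have exponent_le : N * c * ε ^ 2 / σ ^ 2 ≤ 1 / 4 :=
      calc N * c * ε ^ 2 / σ ^ 2 ≤ N * c * (σ ^ 2 / (N * c) / 4) / σ ^ 2 := by gcongr
        _ = 1 / 4 := by field_simp
    linarith [Real.add_one_le_exp (-(N * c * ε ^ 2 / σ ^ 2))]
  refine (ENNReal.ofReal_le_ofReal ?_).trans
    (h.le_minimaxRisk hσ hD₀ hr.le hε (le_of_mul_le_mul_left ?_ (Nat.cast_pos.2 hp)) ?_)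
  · rw [← mul_assoc, pn_mul_sq]
    nlinarith
  · linarith
  · linarith

theorem mul_min_mul_sub_one_le_mul_min {a b x : ℝ} (ha : 0 ≤ a) (hb : 0 ≤ b) (hx : 0 ≤ x) :
    1 / 320 * min a (2 * b * (x / 10 - 1)) ≤ 3 / 16 * min a (b * x) := by
  have min_nonneg : 0 ≤ min a (b * x) := le_min ha (mul_nonneg hb hx)
  have min_le : min a (2 * b * (x / 10 - 1)) ≤ min a (b * x) :=
    min_le_min_left _ (by nlinarith [mul_nonneg hb hx])
  linarith

end Assouad

end DictLearning

end

open DictLearning in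
theorem corollary1_general {m p N : ℕ} (hN : 1 ≤ N) {σ : ℝ≥0} (hσ : 0 < σ) {c : ℝ}
    {μx : Measure (Fin p → ℝ)} [IsProbabilityMeasure μx] (hμx : HasScalarSecondMoment c μx)
    {D₀ : Matrix (Fin m) (Fin p) ℝ} (hD₀ : D₀ ∈ dictionaries m p)
    {r : ℝ} (hr : 0 < r) (hrp : r ≤ 2 * √p)
    {D : Matrix (Fin m) (Fin p) ℝ} (hD : D ∈ dictionaries m p) :
    ENNReal.ofReal (3 / 16 * min (r ^ 2) (p / (SNR μx σ D * N * m) * (p * ((m : ℝ) - 1)))) ≤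
      minimaxRisk μx σ N D₀ r := by
  obtain h_nonpos | h_pos := le_or_gt ((p : ℝ) / (SNR μx σ D * N * m) * (p * ((m : ℝ) - 1))) 0
  · rw [ENNReal.ofReal_of_nonpos (by linarith [min_le_right (r ^ 2) _ |>.trans h_nonpos])]
    exact zero_le
  have hp : 0 < p := Nat.pos_of_ne_zero fun h => by simp [h] at h_pos
  have hm : 1 < m := by
    by_contra hm
    have hm' : (m : ℝ) - 1 ≤ 0 := sub_nonpos.2 (by exact_mod_cast not_lt.1 hm)
    refine h_pos.not_ge (mul_nonpos_of_nonneg_of_nonpos ?_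
      (mul_nonpos_of_nonneg_of_nonpos (by positivity) hm'))
    have := SNR_nonneg μx σ D
    positivity
  have hc : 0 < c := (hμx.nonneg ⟨0, hp⟩).lt_of_ne fun h => by
    simp [hμx.SNR_eq σ hD, ← h] at h_pos
  obtain ⟨n, rfl⟩ := Nat.exists_eq_add_of_le' hm.le
  have bound_eq : (p : ℝ) / (SNR μx σ D * N * (n + 1 : ℕ)) * (p * (((n + 1 : ℕ) : ℝ) - 1)) =
      p * n * (σ ^ 2 / (N * c)) := by
    have hσ' : (σ : ℝ) ≠ 0 := by exact_mod_cast hσ.ne'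
    rw [hμx.SNR_eq σ hD]
    field_simp
    push_cast
    ring
  rw [bound_eq]
  exact hμx.min_le_minimaxRisk hc hσ hN (by omega) hp hD₀ hr hrp

theorem corollary1 (m p s N : ℕ) (hmp : m ≤ p) (hs : 1 ≤ s) (hsp : s ≤ p) (hN : 1 ≤ N)
    (σ : ℝ≥0) (hσ : 0 < σ) (σa : ℝ)
    (μx : Measure (Fin p → ℝ)) [IsProbabilityMeasure μx]
    (hμx : DictLearning.IsSparseCoeffLaw s σa μx)
    (D₀ : Matrix (Fin m) (Fin p) ℝ) (hD₀ : D₀ ∈ DictLearning.dictionaries m p)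
    (r : ℝ) (hr : 0 < r) (hrp : r ≤ 2 * Real.sqrt p)
    (D : Matrix (Fin m) (Fin p) ℝ) (hD : D ∈ DictLearning.neighborhood D₀ r)
    (δ : ℝ) (hδ : δ ≤ 1 / 2) (hRIP : DictLearning.HasRIP D s δ)
    (hdim : 50 ≤ (p : ℝ) * ((m : ℝ) - 1)) :
    (∀ i j, ∫ x, x i * x j ∂μx = if i = j then (s : ℝ) / p * σa ^ 2 else 0) ∧
    ENNReal.ofReal (1 / 320 * min (r ^ 2)
        (2 * (p : ℝ) / (DictLearning.SNR μx σ D * N * m) * ((p : ℝ) * ((m : ℝ) - 1) / 10 - 1)))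
      ≤ DictLearning.minimaxRisk μx σ N D₀ r := by
  refine ⟨hμx.integral_mul hsp, (ENNReal.ofReal_le_ofReal ?_).trans <|
    corollary1_general hN hσ (hμx.hasScalarSecondMoment hsp) hD₀ hr hrp hD.1⟩
  rw [mul_div_assoc]
  have := DictLearning.SNR_nonneg μx σ D
  exact DictLearning.mul_min_mul_sub_one_le_mul_min (sq_nonneg r) (by positivity) (by linarith)
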